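/- Let $n,m\ge 0$ be integers and let $\Delta_n=\{x\in\mathbb{R}^{n+1} : x_i\ge 0,\ \sum_i x_i=1\}$ be the standard $n$-simplex with vertices $e_0,\dots,e_n$. A triangulation of $\Delta_n$ is a finite collection of $n$-dimensional simplices whose union is $\Delta_n$ and any two of which intersect in a (possibly empty) common face. A Sperner labeling of it assigns to each vertex $v$ of the triangulation one of $n+1$ labels such that (1) the original vertices $e_0,\dots,e_n$ receive pairwise distinct labels, and (2) whenever $v$ lies in the face of $\Delta_n$ spanned by $\{e_i : i\in S\}$, the label of $v$ is the label of some $e_i$ with $i\in S$. Let $\lambda_1,\dots,\lambda_m$ be Sperner labelings of a triangulation of $\Delta_n$, and let $k_1,\dots,k_m$ be positive integers with $k_1+\dots+k_m=n+m$. Then there is an $n$-dimensional simplex $\tau$ of the triangulation such that, for every $j\in\{1,\dots,m\}$, the labeling $\lambda_j$ takes at least $k_j$ pairwise distinct values on the vertices of $\tau$. -/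

import Mathlib

/-- A triangulation of the standard `n`-simplex
`Δ_n = {x ∈ ℝ^(n+1) | x_i ≥ 0, ∑ x_i = 1}`: a finite geometric simplicial complex which covers
exactly `Δ_n` and which consists of `n`-dimensional simplices together with their faces.
(That any two simplices meet in a common, possibly empty, face is part of
`Geometry.SimplicialComplex`; a simplex is given by the finite set of its vertices.) -/
structure IsTriangulation {n : ℕ} (T : Geometry.SimplicialComplex ℝ (Fin (n + 1) → ℝ)) :
    Prop where
  finite : T.faces.Finite
  space_eq : T.space = stdSimplex ℝ (Fin (n + 1))
  pure : ∀ s ∈ T.faces, ∃ t ∈ T.faces, s ⊆ t ∧ t.card = n + 1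

/-- The `i`-th original vertex `e_i` of `Δ_n`. -/
def simplexVertex {n : ℕ} (i : Fin (n + 1)) : Fin (n + 1) → ℝ := Pi.single i 1

/-- A Sperner labeling, by the `n + 1` labels in `Fin (n + 1)`, of the vertices of a triangulation
`T` of `Δ_n`. The original vertices of `Δ_n` receive distinct labels, and every vertex of `T` that
lies in the face of `Δ_n` spanned by the `e_i` with `i ∈ S` receives the label of one of these
`e_i`. The values of `l` at points that are not vertices of `T` are irrelevant. -/
structure IsSpernerLabeling {n : ℕ} (T : Geometry.SimplicialComplex ℝ (Fin (n + 1) → ℝ))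
    (l : (Fin (n + 1) → ℝ) → Fin (n + 1)) : Prop where
  injective : Function.Injective fun i : Fin (n + 1) => l (simplexVertex i)
  mem_face : ∀ v ∈ T.vertices, ∀ S : Set (Fin (n + 1)),
    v ∈ convexHull ℝ (simplexVertex '' S) → ∃ i ∈ S, l v = l (simplexVertex i)

open Filter Topology

/-! Give labeling j the mass (k_j - 1 + 1/m)/(n+1); these masses sum to 1. Send each vertex to the
average, with these masses, of the m original vertices carrying its labels, and extend affinely over
each simplex. The Sperner condition makes this map preserve faces, so it hits the barycenter. Over a
simplex where it does, labeling j spreads its mass over the coordinates of the labels it uses, at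
most 1/(n+1) on each. It therefore uses at least k_j - 1 + 1/m labels, hence at least k_j.

That a face-preserving map hits interior points (`exists_eq_of_preserves_faces`) is a limit of a
Sperner-type statement on lattice points (`exists_close_lattice_points`), which comes from Scarf's
lemma, a parity argument. `exists_continuousOn_affine_extension` supplies the continuous map. -/

/-- `Z` is dominant for the orders given by the functions `u i` if every element is weakly below
all of `Z` in one of these orders. -/
def IsDominant {V I α : Type*} [LinearOrder α] (u : I → V → α) (Z : Finset V) : Prop :=
  ∀ x, ∃ i, ∀ z ∈ Z, u i x ≤ u i z

theorem IsDominant.subset {V I α : Type*} [LinearOrder α] {u : I → V → α} {Z W : Finset V}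
    (hW : IsDominant u W) (h : Z ⊆ W) :
    IsDominant u Z := fun x => by
  obtain ⟨i, hi⟩ := hW x
  exact ⟨i, fun z hz => hi z (h hz)⟩

/-! ### Scarf's lemma by double counting -/

section Scarf

variable {V I α : Type*} [DecidableEq V] [Fintype I] [DecidableEq I] [LinearOrder α]

/-- A set with `|I|` elements coloured by `I` has an even number of facets with colours
`I \ {i₀}`, unless it has all the colours. -/
theorem even_card_facets_of_not_rainbow (c : V → I) (i₀ : I) (W : Finset V)
    (hW : W.card = Fintype.card I) (hr : W.image c ≠ Finset.univ) :
    Even (W.filter fun y => (W.erase y).image c = Finset.univ.erase i₀).card := by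
  rcases Finset.eq_empty_or_nonempty
    (W.filter fun y => (W.erase y).image c = Finset.univ.erase i₀) with h | ⟨y, hy⟩
  · simp [h]
  rw [Finset.mem_filter] at hy
  obtain ⟨hyW, hy⟩ := hy
  have hcard : (W.erase y).card = (Finset.univ.erase i₀ : Finset I).card := by
    rw [Finset.card_erase_of_mem hyW, Finset.card_erase_of_mem (Finset.mem_univ _), hW,
      Finset.card_univ]
  have hinj : Set.InjOn c (W.erase y : Finset V) := by
    apply Finset.injOn_of_card_image_eq
    rw [hy, hcard]
  have hcy : c y ≠ i₀ := by
    intro h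
    apply hr
    rw [← Finset.insert_erase hyW, Finset.image_insert, hy, h,
      Finset.insert_erase (Finset.mem_univ _)]
  -- The colour of `y` recurs exactly once, at `y'`; only these two can be removed without losing a
  -- colour.
  have : c y ∈ (W.erase y).image c := by rw [hy]; simp [hcy]
  obtain ⟨y', hy', hcc⟩ := Finset.mem_image.1 this
  have hne : y' ≠ y := Finset.ne_of_mem_erase hy'
  have hset : (W.filter fun y => (W.erase y).image c = Finset.univ.erase i₀) = {y, y'} := by
    ext z
    simp only [Finset.mem_filter, Finset.mem_insert, Finset.mem_singleton]
    constructor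
    · rintro ⟨hzW, hz⟩
      by_contra! hcon
      have hzi : c z ∈ (W.erase z).image c := by
        rw [hz, ← hy]
        exact Finset.mem_image_of_mem _ (Finset.mem_erase.2 ⟨hcon.1, hzW⟩)
      obtain ⟨w, hw, hwz⟩ := Finset.mem_image.1 hzi
      have hwz' := Finset.ne_of_mem_erase hw
      by_cases hwy : w = y
      · subst hwy
        exact hcon.2 (hinj (by simp [hcon.1, hzW]) hy' (by rw [← hwz, hcc]))
      · exact hwz' (hinj (by simp [hwy, Finset.mem_of_mem_erase hw]) (by simp [hcon.1, hzW]) hwz)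
    · rintro (rfl | rfl)
      · exact ⟨hyW, hy⟩
      · refine ⟨Finset.mem_of_mem_erase hy', ?_⟩
        rw [← hy]
        ext i
        simp only [Finset.mem_image, Finset.mem_erase]
        constructor
        · rintro ⟨w, ⟨hw1, hw2⟩, rfl⟩
          by_cases hwy : w = y
          · subst hwy; exact ⟨z, ⟨hne, Finset.mem_of_mem_erase hy'⟩, hcc⟩
          · exact ⟨w, ⟨hwy, hw2⟩, rfl⟩
        · rintro ⟨w, ⟨hw1, hw2⟩, rfl⟩
          by_cases hwy : w = z
          · subst hwy; exact ⟨y, ⟨hne.symm, hyW⟩, hcc.symm⟩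
          · exact ⟨w, ⟨hwy, hw2⟩, rfl⟩
  rw [hset, Finset.card_pair hne.symm]
  exact even_two

variable {u : I → V → α}

/-- A dominant set with `|I| - 1` elements, one of which lies below all the `s k` in the orders
`i ≠ k`, extends in exactly two ways to a dominant set with `|I|` elements. -/
theorem IsDominant.card_extensions [Fintype V] (hu : ∀ i, Function.Injective (u i)) (s : I → V)
    {Z : Finset V} (hZ : IsDominant u Z) (hcard : Z.card + 1 = Fintype.card I)
    {y : V} (hy : y ∈ Z) (hys : ∀ i k, i ≠ k → u i y < u i (s k))
    [DecidablePred fun x => x ∉ Z ∧ IsDominant u (insert x Z)] :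
    (Finset.univ.filter fun x => x ∉ Z ∧ IsDominant u (insert x Z)).card = 2 := by
  classical
  have hmin : ∀ i, ∃ a ∈ Z, ∀ z ∈ Z, u i a ≤ u i z := fun i =>
    Finset.exists_min_image Z (u i) ⟨y, hy⟩
  choose a haZ ha using hmin
  -- By dominance every element of `Z` is the minimum in some order. There is one more order than
  -- elements, so exactly one pair of orders shares its minimum.
  have hsurj : ∀ z ∈ Z, ∃ i, a i = z := fun z hz => by
    obtain ⟨i, hi⟩ := hZ z
    exact ⟨i, hu i (le_antisymm (ha i z hz) (hi _ (haZ i)))⟩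
  have himg : Finset.univ.image a = Z := by
    ext z
    simp only [Finset.mem_image, Finset.mem_univ, true_and]
    exact ⟨by rintro ⟨i, rfl⟩; exact haZ i, hsurj z⟩
  obtain ⟨i₁, -, i₂, -, hne, h12⟩ := Finset.exists_ne_map_eq_of_card_lt_of_maps_to
    (s := (Finset.univ : Finset I)) (t := Z) (by rw [Finset.card_univ]; omega)
    (f := a) (fun i _ => haZ i)
  -- after removing one of the two indices, `a` is a bijection onto `Z`
  have hsurj' : ∀ k, k = i₁ ∨ k = i₂ → ∀ z ∈ Z, ∃ i, i ≠ k ∧ a i = z := by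
    intro k hk z hz
    obtain ⟨i, hi⟩ := hsurj z hz
    by_cases hik : i = k
    · rcases hk with rfl | rfl
      · exact ⟨i₂, hne.symm, by rw [← h12, ← hik, hi]⟩
      · exact ⟨i₁, hne, by rw [h12, ← hik, hi]⟩
    · exact ⟨i, hik, hi⟩
  have hinj' : ∀ k, k = i₁ ∨ k = i₂ → Set.InjOn a (Finset.univ.erase k : Finset I) := by
    intro k hk
    apply Finset.injOn_of_card_image_eq
    have : (Finset.univ.erase k).image a = Z := by
      ext z
      simp only [Finset.mem_image, Finset.mem_erase, Finset.mem_univ, and_true]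
      exact ⟨by rintro ⟨i, -, rfl⟩; exact haZ i, hsurj' k hk z⟩
    rw [this, Finset.card_erase_of_mem (Finset.mem_univ _), Finset.card_univ]
    omega
  -- An added element becomes the minimum in one order `k` and lies above the old minima in the
  -- others. So `a` is bijective off `k`, which forces `k` to be `i₁` or `i₂`, and dominance makes
  -- the new element the `u k`-largest of `M k`.
  let M : I → Finset V := fun k => Finset.univ.filter fun x => ∀ i, i ≠ k → u i (a i) < u i x
  have hM : ∀ k x, x ∈ M k ↔ ∀ i, i ≠ k → u i (a i) < u i x := fun k x => by simp [M]
  have hMne : ∀ k, ∃ x ∈ M k, ∀ z ∈ M k, u k z ≤ u k x := fun k =>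
    Finset.exists_max_image _ _ ⟨s k, (hM _ _).2 fun i hi => (ha i y hy).trans_lt (hys i k hi)⟩
  choose x hxM hx using hMne
  have hdom : ∀ k, k = i₁ ∨ k = i₂ → x k ∉ Z ∧ IsDominant u (insert (x k) Z) := by
    intro k hk
    constructor
    · intro h
      obtain ⟨i, hik, hi⟩ := hsurj' k hk _ h
      exact ((hM _ _).1 (hxM k) i hik).ne (by rw [hi])
    · intro z
      by_cases hz : z ∈ M k
      · obtain ⟨i, hi⟩ := hZ z
        have hik : i = k := by
          by_contra hik
          exact absurd (hi _ (haZ i)) (not_le.2 ((hM _ _).1 hz i hik))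
        subst hik
        exact ⟨i, Finset.forall_mem_insert _ _ _ |>.2 ⟨hx i z hz, hi⟩⟩
      · rw [hM] at hz
        push Not at hz
        obtain ⟨i, hik, hi⟩ := hz
        exact ⟨i, Finset.forall_mem_insert _ _ _ |>.2
          ⟨hi.trans ((hM _ _).1 (hxM k) i hik).le, fun w hw => hi.trans (ha i w hw)⟩⟩
  have hxne : x i₁ ≠ x i₂ := by
    intro h
    obtain ⟨i, hi⟩ := hZ (x i₁)
    have hi := hi _ (haZ i)
    by_cases h1 : i = i₁
    · rw [h] at hi
      exact absurd hi (not_le.2 ((hM _ _).1 (hxM i₂) i (by rw [h1]; exact hne)))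
    · exact absurd hi (not_le.2 ((hM _ _).1 (hxM i₁) i h1))
  have hset : (Finset.univ.filter fun x => x ∉ Z ∧ IsDominant u (insert x Z)) =
      {x i₁, x i₂} := by
    ext w
    simp only [Finset.mem_filter, Finset.mem_univ, true_and, Finset.mem_insert,
      Finset.mem_singleton]
    constructor
    · rintro ⟨hwZ, hw⟩
      obtain ⟨k, hk⟩ := hw w
      have hother : ∀ z ∈ Z, ∃ i, i ≠ k ∧ a i = z ∧ u i z < u i w := by
        intro z hz
        obtain ⟨i, hi⟩ := hw z
        have hlt : u i z < u i w := lt_of_le_of_ne (hi w (by simp))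
          (fun h => hwZ (hu i h ▸ hz))
        refine ⟨i, ?_, hu i (le_antisymm (ha i z hz) (hi _ (by simp [haZ]))), hlt⟩
        rintro rfl
        exact absurd (hk z (by simp [hz])) (not_le.2 hlt)
      have hinjk : Set.InjOn a (Finset.univ.erase k : Finset I) := by
        apply Finset.injOn_of_card_image_eq
        have : (Finset.univ.erase k).image a = Z := by
          ext z
          simp only [Finset.mem_image, Finset.mem_erase, Finset.mem_univ, and_true]
          refine ⟨by rintro ⟨i, -, rfl⟩; exact haZ i, fun hz => ?_⟩
          obtain ⟨i, h1, h2, -⟩ := hother z hz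
          exact ⟨i, h1, h2⟩
        rw [this, Finset.card_erase_of_mem (Finset.mem_univ _), Finset.card_univ]
        omega
      have hkk : k = i₁ ∨ k = i₂ := by
        by_contra! hcon
        exact hne (hinjk (by simp [hcon.1.symm]) (by simp [hcon.2.symm]) h12)
      have hwM : w ∈ M k := by
        rw [hM]
        intro i hik
        obtain ⟨j, hjk, hj, hlt⟩ := hother _ (haZ i)
        have : j = i := hinjk (by simpa using hjk) (by simpa using hik) hj
        rwa [this] at hlt
      have hwx : w = x k := by
        apply hu k
        refine le_antisymm (hx k w hwM) ?_
        obtain ⟨i, hi⟩ := hw (x k)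
        have hik : i = k := by
          by_contra hik
          exact absurd (hi _ (by simp [haZ])) (not_le.2 ((hM _ _).1 (hxM k) i hik))
        subst hik
        exact hi w (by simp)
      rcases hkk with rfl | rfl
      · exact Or.inl hwx
      · exact Or.inr hwx
    · rintro (rfl | rfl)
      · exact hdom _ (Or.inl rfl)
      · exact hdom _ (Or.inr rfl)
  rw [hset, Finset.card_pair hxne]

/-- **Scarf's lemma** for linear orders with slack elements `s i`. -/
theorem exists_rainbow_isDominant [Fintype V] (hu : ∀ i, Function.Injective (u i)) (s : I → V)
    (c : V → I) (hc : ∀ i, c (s i) = i) (hbot : ∀ i v, u i (s i) ≤ u i v)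
    (htop : ∀ i j v, i ≠ j → v ∉ Set.range s → u i v < u i (s j))
    {x₀ : V} (hx₀ : x₀ ∉ Set.range s) :
    ∃ Z : Finset V, Z.card = Fintype.card I ∧ IsDominant u Z ∧ Z.image c = Finset.univ := by
  classical
  by_contra! hcon
  have hs : Function.Injective s := fun i j h => by rw [← hc i, h, hc]
  let i₀ : I := c x₀
  have hpos : 0 < Fintype.card I := Fintype.card_pos_iff.2 ⟨i₀⟩
  -- Count pairs `Z ⊆ W` with `Z` in `D` and `W` in `R`. Without a rainbow `W` the count is even
  -- over `W`; over `Z` it is odd, as all have two extensions except `Z₀`, which has one.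
  let D : Finset (Finset V) := Finset.univ.filter fun Z =>
    Z.card + 1 = Fintype.card I ∧ IsDominant u Z ∧ Z.image c = Finset.univ.erase i₀
  let R : Finset (Finset V) := Finset.univ.filter fun W =>
    W.card = Fintype.card I ∧ IsDominant u W
  have hcount := Finset.sum_card_bipartiteAbove_eq_sum_card_bipartiteBelow
    (s := D) (t := R) (fun Z W => Z ⊆ W)
  have hR : Even (∑ W ∈ R, (D.bipartiteBelow (fun Z W => Z ⊆ W) W).card) := by
    refine Finset.even_sum _ fun W hW => ?_
    simp only [R, Finset.mem_filter, Finset.mem_univ, true_and] at hW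
    suffices h : (W.filter fun y => (W.erase y).image c = Finset.univ.erase i₀).card =
        (D.bipartiteBelow (fun Z W => Z ⊆ W) W).card by
      rw [← h]
      exact even_card_facets_of_not_rainbow c i₀ W hW.1 (hcon W hW.1 hW.2)
    refine Finset.card_bij (fun y _ => W.erase y) ?_ ?_ ?_
    · intro y hy
      rw [Finset.mem_filter] at hy
      simp only [Finset.bipartiteBelow, D, Finset.mem_filter, Finset.mem_univ, true_and]
      refine ⟨⟨?_, hW.2.subset (Finset.erase_subset _ _), hy.2⟩, Finset.erase_subset _ _⟩
      rw [Finset.card_erase_of_mem hy.1, hW.1]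
      omega
    · intro y hy y' hy' h
      exact Finset.erase_injOn W (Finset.mem_filter.1 hy).1 (Finset.mem_filter.1 hy').1 h
    · intro Z hZ
      simp only [Finset.bipartiteBelow, D, Finset.mem_filter, Finset.mem_univ, true_and] at hZ
      obtain ⟨⟨hZ1, hZ2, hZ3⟩, hZW⟩ := hZ
      obtain ⟨y, hy⟩ : ∃ y, W \ Z = {y} := by
        rw [← Finset.card_eq_one, Finset.card_sdiff_of_subset hZW]
        omega
      have hyW : y ∈ W \ Z := by simp [hy]
      rw [Finset.mem_sdiff] at hyW
      have hZe : W.erase y = Z := by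
        rw [Finset.erase_eq, ← hy, Finset.sdiff_sdiff_eq_self hZW]
      exact ⟨y, by rw [Finset.mem_filter, hZe]; exact ⟨hyW.1, hZ3⟩, hZe⟩
  have hext : ∀ Z, Z.card + 1 = Fintype.card I →
      (R.bipartiteAbove (fun Z W => Z ⊆ W) Z).card =
        (Finset.univ.filter fun x => x ∉ Z ∧ IsDominant u (insert x Z)).card := by
    intro Z hZ
    symm
    refine Finset.card_bij (fun x _ => insert x Z) ?_ ?_ ?_
    · intro x hx
      simp only [Finset.mem_filter, Finset.mem_univ, true_and] at hx
      simp only [Finset.bipartiteAbove, R, Finset.mem_filter, Finset.mem_univ, true_and]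
      exact ⟨⟨by rw [Finset.card_insert_of_notMem hx.1, hZ], hx.2⟩, Finset.subset_insert _ _⟩
    · intro x hx y hy h
      simp only [Finset.mem_filter, Finset.mem_univ, true_and] at hx
      exact (Finset.insert_inj hx.1).1 h
    · intro W hW
      simp only [Finset.bipartiteAbove, R, Finset.mem_filter, Finset.mem_univ, true_and] at hW
      obtain ⟨⟨hW1, hW2⟩, hZW⟩ := hW
      obtain ⟨y, hy⟩ : ∃ y, W \ Z = {y} := by
        rw [← Finset.card_eq_one, Finset.card_sdiff_of_subset hZW]
        omega
      have hyW : y ∈ W \ Z := by simp [hy]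
      rw [Finset.mem_sdiff] at hyW
      have hins : insert y Z = W := by
        rw [Finset.insert_eq, ← hy, Finset.sdiff_union_of_subset hZW]
      exact ⟨y, by simpa [hins] using ⟨hyW.2, hW2⟩, hins⟩
  -- the unique facet consisting of slack elements
  let Z₀ : Finset V := (Finset.univ.erase i₀).image s
  have hZ₀ : ∀ z, z ∈ Z₀ ↔ ∃ i, i ≠ i₀ ∧ s i = z := fun z => by simp [Z₀]
  have hdom₀ : ∀ w, w ∉ Set.range s → ∀ z ∈ Z₀, u i₀ w ≤ u i₀ z := by
    intro w hw z hz
    obtain ⟨i, hi, rfl⟩ := (hZ₀ z).1 hz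
    exact (htop i₀ i w hi.symm hw).le
  have hZ₀card : Z₀.card + 1 = Fintype.card I := by
    rw [Finset.card_image_of_injective _ hs, Finset.card_erase_of_mem (Finset.mem_univ _),
      Finset.card_univ]
    omega
  have hZ₀D : Z₀ ∈ D := by
    simp only [D, Finset.mem_filter, Finset.mem_univ, true_and]
    refine ⟨hZ₀card, fun w => ?_, ?_⟩
    · by_cases hw : w ∈ Set.range s
      · obtain ⟨i, rfl⟩ := hw
        exact ⟨i, fun z _ => hbot i z⟩
      · exact ⟨i₀, hdom₀ w hw⟩
    · rw [Finset.image_image, show c ∘ s = id from funext hc, Finset.image_id]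
  have hone : (R.bipartiteAbove (fun Z W => Z ⊆ W) Z₀).card = 1 := by
    rw [hext _ hZ₀card, Finset.card_eq_one]
    obtain ⟨x, hx, hmax⟩ := Finset.exists_max_image
      (Finset.univ.filter fun x => x ∉ Set.range s) (u i₀) ⟨x₀, by simpa using hx₀⟩
    simp only [Finset.mem_filter, Finset.mem_univ, true_and] at hx hmax
    refine ⟨x, ?_⟩
    -- In an order `i ≠ i₀` the bottom element `s i` lies in `Z₀`, so a non-slack element can only
    -- be dominated in the order `i₀`.
    have hkey : ∀ w, IsDominant u (insert w Z₀) → ∀ v, v ∉ Set.range s → u i₀ v ≤ u i₀ w := by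
      intro w hw v hv
      obtain ⟨i, hi⟩ := hw v
      by_cases hi0 : i = i₀
      · subst hi0
        exact hi w (by simp)
      · exact absurd ⟨i, hu i (le_antisymm (hbot i v) (hi (s i) (by
          rw [Finset.mem_insert, hZ₀]; exact Or.inr ⟨i, hi0, rfl⟩)))⟩ hv
    ext w
    simp only [Finset.mem_filter, Finset.mem_univ, true_and, Finset.mem_singleton]
    constructor
    · rintro ⟨hwZ, hw⟩
      have hws : w ∉ Set.range s := by
        rintro ⟨i, rfl⟩
        have hi : i = i₀ := by
          by_contra hi
          exact hwZ ((hZ₀ _).2 ⟨i, hi, rfl⟩)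
        subst hi
        exact hx₀ ⟨_, hu _ (le_antisymm (hbot _ _) (hkey _ hw x₀ hx₀))⟩
      exact hu i₀ (le_antisymm (hmax w hws) (hkey w hw x hx))
    · rintro rfl
      refine ⟨fun h => ?_, fun v => ?_⟩
      · obtain ⟨i, -, hi⟩ := (hZ₀ _).1 h
        exact hx ⟨i, hi⟩
      · by_cases hv : v ∈ Set.range s
        · obtain ⟨i, rfl⟩ := hv
          exact ⟨i, fun z _ => hbot i z⟩
        · exact ⟨i₀, Finset.forall_mem_insert _ _ _ |>.2 ⟨hmax v hv, hdom₀ v hv⟩⟩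
  have htwo : ∀ Z ∈ D.erase Z₀, Even (R.bipartiteAbove (fun Z W => Z ⊆ W) Z).card := by
    intro Z hZ
    rw [Finset.mem_erase] at hZ
    obtain ⟨hne, hZ⟩ := hZ
    simp only [D, Finset.mem_filter, Finset.mem_univ, true_and] at hZ
    obtain ⟨hZ1, hZ2, hZ3⟩ := hZ
    obtain ⟨y, hyZ, hy⟩ : ∃ y ∈ Z, y ∉ Set.range s := by
      by_contra! hall
      apply hne
      refine Finset.eq_of_subset_of_card_le (fun z hz => ?_) (by omega)
      obtain ⟨i, rfl⟩ := hall z hz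
      refine (hZ₀ _).2 ⟨i, ?_, rfl⟩
      have : c (s i) ∈ Z.image c := Finset.mem_image_of_mem _ hz
      rw [hZ3, hc] at this
      exact Finset.ne_of_mem_erase this
    have h2 := hZ2.card_extensions hu s hZ1 hyZ (fun i k hik => htop i k y hik hy)
    rw [hext _ hZ1, h2]
    exact even_two
  rw [← hcount, ← Finset.add_sum_erase _ _ hZ₀D, hone] at hR
  have := Finset.even_sum _ htwo
  rw [Nat.even_add] at hR
  exact absurd (hR.2 this) (by decide)

end Scarf

/-! ### A Sperner-type lemma on lattice points -/

/-- For every colouring of the lattice points of the dilated simplex by its coordinates there is a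
set `C` of coordinates, and lattice points of each colour in `C`, all close to each other and to
the face spanned by `C`. -/
theorem exists_close_lattice_points (n N : ℕ) (c : (Fin (n + 1) → ℤ) → Fin (n + 1)) :
    ∃ (C : Finset (Fin (n + 1))) (y : Fin (n + 1) → Fin (n + 1) → ℤ), C.Nonempty ∧
      (∀ i ∈ C, (∀ k, 0 ≤ y i k) ∧ ∑ k, y i k = N ∧ c (y i) = i) ∧
      (∀ i ∈ C, ∀ j ∈ C, ∀ k, |y i k - y j k| ≤ n + 1) ∧
      ∀ i ∈ C, ∀ k ∉ C, y i k ≤ n + 1 := by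
  classical
  let L : Finset (Fin (n + 1) → ℤ) :=
    (Finset.Icc (fun _ => 0) (fun _ => (N : ℤ))).filter fun v => ∑ k, v k = N
  have hL : ∀ v, v ∈ L ↔ (∀ k, 0 ≤ v k) ∧ ∑ k, v k = N := by
    intro v
    simp only [L, Finset.mem_filter, Finset.mem_Icc, Pi.le_def]
    refine ⟨fun h => ⟨h.1.1, h.2⟩, fun h => ⟨⟨h.1, fun k => ?_⟩, h.2⟩⟩
    rw [← h.2]
    exact Finset.single_le_sum (fun j _ => h.1 j) (Finset.mem_univ k)
  have hLN : ∀ v ∈ L, ∀ k, v k ≤ N := fun v hv k => by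
    rw [← ((hL v).1 hv).2]
    exact Finset.single_le_sum (fun j _ => ((hL v).1 hv).1 j) (Finset.mem_univ k)
  -- The entries -1 and N + 1 lie just outside the range [0, N] of lattice coordinates, as the slack
  -- elements require.
  let vec : L ⊕ Fin (n + 1) → Fin (n + 1) → ℤ :=
    Sum.elim (fun v => v.1) (fun i k => if k = i then -1 else N + 1)
  have hvec : Function.Injective vec := by
    rintro (v | i) (w | j) h
    · exact congrArg _ (Subtype.ext h)
    · have := congrFun h j
      simp only [vec, Sum.elim_inl, Sum.elim_inr, if_true] at this
      have := ((hL _).1 v.2).1 j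
      omega
    · have := congrFun h i
      simp only [vec, Sum.elim_inl, Sum.elim_inr, if_true] at this
      have := ((hL _).1 w.2).1 i
      omega
    · have := congrFun h i
      simp only [vec, Sum.elim_inr, if_true] at this
      by_cases hij : i = j
      · rw [hij]
      · rw [if_neg hij] at this
        omega
  -- Coordinate `i` is compared first; the whole vector breaks ties.
  let u : Fin (n + 1) → L ⊕ Fin (n + 1) → ℤ ×ₗ Lex (Fin (n + 1) → ℤ) := fun i v =>
    toLex (vec v i, toLex (vec v))
  have hle : ∀ i v w, u i v ≤ u i w → vec v i ≤ vec w i := fun i v w h => by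
    rcases Prod.Lex.le_iff.1 h with h | h
    · exact le_of_lt h
    · exact le_of_eq h.1
  have hlt : ∀ i v w, vec v i < vec w i → u i v < u i w := fun i v w h =>
    Prod.Lex.lt_iff.2 (Or.inl h)
  have hx₀ : Pi.single 0 (N : ℤ) ∈ L := by
    rw [hL]
    refine ⟨fun k => ?_, by simp⟩
    by_cases hk : k = 0
    · subst hk; simp
    · simp [hk]
  obtain ⟨Z, hZ, hdom, hrb⟩ := exists_rainbow_isDominant (u := u)
    (fun i v w h => hvec (by
      have := congrArg (fun z => ofLex (ofLex z).2) h
      exact this))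
    Sum.inr (Sum.elim (fun v => c v.1) id) (fun i => rfl)
    (by
      rintro i (v | j)
      · refine (hlt _ _ _ ?_).le
        have := ((hL _).1 v.2).1 i
        simp only [vec, Sum.elim_inl, Sum.elim_inr, if_true]
        omega
      · by_cases hij : i = j
        · rw [hij]
        · refine (hlt _ _ _ ?_).le
          simp only [vec, Sum.elim_inr, if_true, if_neg hij]
          omega)
    (by
      rintro i j (v | j') hij hv
      · refine hlt _ _ _ ?_
        have := hLN _ v.2 i
        simp only [vec, Sum.elim_inl, Sum.elim_inr, if_neg hij]
        omega
      · exact absurd ⟨j', rfl⟩ hv)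
    (x₀ := Sum.inl ⟨_, hx₀⟩) (by simp)
  let C : Finset (Fin (n + 1)) := Finset.univ.filter fun i => Sum.inr i ∉ Z
  have hCmem : ∀ i, i ∈ C ↔ Sum.inr i ∉ Z := fun i => by simp [C]
  have hex : ∀ i, ∃ v : Fin (n + 1) → ℤ, i ∈ C → ∃ h : v ∈ L, Sum.inl ⟨v, h⟩ ∈ Z ∧ c v = i := by
    intro i
    by_cases hi : i ∈ C
    · have : i ∈ Z.image (Sum.elim (fun v => c v.1) id) := by rw [hrb]; simp
      obtain ⟨z, hz, hzi⟩ := Finset.mem_image.1 this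
      rcases z with v | j
      · exact ⟨v.1, fun _ => ⟨v.2, hz, hzi⟩⟩
      · simp only [Sum.elim_inr, id] at hzi
        exact absurd (hzi ▸ hz) ((hCmem i).1 hi)
    · exact ⟨0, fun h => absurd h hi⟩
  choose y hy using hex
  -- A slack element `i` in `Z` has entry -1 there, so order `i` dominates no lattice point: only
  -- orders in `C` matter.
  have hdom' : ∀ v ∈ L, ∃ i ∈ C, ∀ j ∈ C, v i ≤ y j i := by
    intro v hv
    obtain ⟨i, hi⟩ := hdom (Sum.inl ⟨v, hv⟩)
    refine ⟨i, ?_, fun j hj => ?_⟩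
    · rw [hCmem]
      intro hiZ
      have h1 := hle _ _ _ (hi _ hiZ)
      simp only [vec, Sum.elim_inl, Sum.elim_inr, if_true] at h1
      have := ((hL _).1 hv).1 i
      omega
    · obtain ⟨h, hjZ, -⟩ := hy j hj
      exact hle _ _ _ (hi _ hjZ)
  have hCne : C.Nonempty := by
    obtain ⟨i, hi, -⟩ := hdom' _ hx₀
    exact ⟨i, hi⟩
  have hμ : ∀ i, ∃ j ∈ C, ∀ j' ∈ C, y j i ≤ y j' i := fun i =>
    Finset.exists_min_image C (fun j => y j i) hCne
  choose μ hμC hμ using hμ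
  have hyL : ∀ i ∈ C, (∀ k, 0 ≤ y i k) ∧ ∑ k, y i k = N := fun i hi =>
    (hL _).1 (hy i hi).1
  -- Otherwise, adding the surplus to one coordinate gives a lattice point above the minimum in
  -- every coordinate of `C`, against `hdom'`. Hence each `y j` has total excess over the minima on
  -- `C`, plus mass off `C`, below |C| ≤ n + 1.
  have hsum : (N : ℤ) < ∑ i ∈ C, (y (μ i) i + 1) := by
    by_contra! hcon
    obtain ⟨i₁, hi₁⟩ := hCne
    let v : Fin (n + 1) → ℤ := fun i => (if i ∈ C then y (μ i) i + 1 else 0) +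
      if i = i₁ then N - ∑ i ∈ C, (y (μ i) i + 1) else 0
    have hv : v ∈ L := by
      rw [hL]
      constructor
      · intro k
        have := (hyL _ (hμC k)).1 k
        simp only [v]
        split_ifs <;> omega
      · simp [v, Finset.sum_add_distrib]
    obtain ⟨i, hi, hvi⟩ := hdom' v hv
    have := hvi _ (hμC i)
    simp only [v, if_pos hi] at this
    split_ifs at this <;> omega
  have hCcard : (C.card : ℤ) ≤ n + 1 := by
    have := Finset.card_le_univ C
    rw [Fintype.card_fin] at this
    exact_mod_cast this
  rw [Finset.sum_add_distrib, Finset.sum_const, nsmul_eq_mul, mul_one] at hsum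
  have hsplit : ∀ j ∈ C, ∑ i ∈ C, y j i + ∑ i ∈ Cᶜ, y j i = N := fun j hj => by
    rw [Finset.sum_add_sum_compl, (hyL j hj).2]
  have hsmall : ∀ j ∈ C, ∑ i ∈ C, (y j i - y (μ i) i) + ∑ i ∈ Cᶜ, y j i ≤ n + 1 := by
    intro j hj
    rw [Finset.sum_sub_distrib]
    have := hsplit j hj
    omega
  have hin : ∀ j ∈ C, ∀ i ∈ C, y j i - y (μ i) i ≤ n + 1 := by
    intro j hj i hi
    have h1 : y j i - y (μ i) i ≤ ∑ i ∈ C, (y j i - y (μ i) i) :=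
      Finset.single_le_sum (f := fun i => y j i - y (μ i) i)
        (fun k _ => sub_nonneg.2 (hμ k j hj)) hi
    have h2 : 0 ≤ ∑ i ∈ Cᶜ, y j i := Finset.sum_nonneg fun k _ => (hyL j hj).1 k
    have := hsmall j hj
    omega
  have hout : ∀ j ∈ C, ∀ i ∉ C, y j i ≤ n + 1 := by
    intro j hj i hi
    have h1 : y j i ≤ ∑ i ∈ Cᶜ, y j i :=
      Finset.single_le_sum (fun k _ => (hyL j hj).1 k) (Finset.mem_compl.2 hi)
    have h2 : 0 ≤ ∑ i ∈ C, (y j i - y (μ i) i) :=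
      Finset.sum_nonneg fun k _ => sub_nonneg.2 (hμ k j hj)
    have := hsmall j hj
    omega
  refine ⟨C, y, hCne, fun i hi => ⟨(hyL i hi).1, (hyL i hi).2, ?_⟩, fun i hi j hj k => ?_, hout⟩
  · obtain ⟨_, -, h⟩ := hy i hi
    exact h
  · rw [abs_le]
    by_cases hk : k ∈ C
    · have h1 := hin i hi k hk
      have h2 := hin j hj k hk
      have h3 := hμ k i hi
      have h4 := hμ k j hj
      omega
    · have h1 := hout i hi k hk
      have h2 := hout j hj k hk
      have h3 := (hyL i hi).1 k
      have h4 := (hyL j hj).1 k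
      omega

/-! ### Passage to the limit -/

/-- A continuous self-map of the standard simplex which preserves its faces attains every
interior point. -/
theorem exists_eq_of_preserves_faces {n : ℕ} (f : (Fin (n + 1) → ℝ) → Fin (n + 1) → ℝ)
    (hf : ContinuousOn f (stdSimplex ℝ (Fin (n + 1))))
    (hmaps : Set.MapsTo f (stdSimplex ℝ (Fin (n + 1))) (stdSimplex ℝ (Fin (n + 1))))
    (hface : ∀ x ∈ stdSimplex ℝ (Fin (n + 1)), ∀ i, x i = 0 → f x i = 0)
    {b : Fin (n + 1) → ℝ} (hb : b ∈ stdSimplex ℝ (Fin (n + 1))) (hpos : ∀ i, 0 < b i) :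
    ∃ x ∈ stdSimplex ℝ (Fin (n + 1)), f x = b := by
  have hcolor : ∀ x ∈ stdSimplex ℝ (Fin (n + 1)), ∃ i, f x i ≤ b i := by
    intro x hx
    by_contra! hcon
    have h := Finset.sum_lt_sum_of_nonempty Finset.univ_nonempty fun i _ => hcon i
    rw [hb.2, (hmaps hx).2] at h
    exact lt_irrefl _ h
  let pt : ℕ → (Fin (n + 1) → ℤ) → Fin (n + 1) → ℝ := fun N v k => (v k : ℝ) / (N + 1)
  have hpt : ∀ (N : ℕ) (v : Fin (n + 1) → ℤ), (∀ k, 0 ≤ v k) → ∑ k, v k = ((N + 1 : ℕ) : ℤ) →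
      pt N v ∈ stdSimplex ℝ (Fin (n + 1)) := by
    intro N v h0 h1
    have hN : (0 : ℝ) < N + 1 := by positivity
    refine ⟨fun k => div_nonneg (by exact_mod_cast h0 k) hN.le, ?_⟩
    simp only [pt]
    rw [← Finset.sum_div, div_eq_one_iff_eq hN.ne']
    exact_mod_cast h1
  have hc : ∀ N : ℕ, ∃ c : (Fin (n + 1) → ℤ) → Fin (n + 1), ∀ v, (∀ k, 0 ≤ v k) →
      ∑ k, v k = ((N + 1 : ℕ) : ℤ) → f (pt N v) (c v) ≤ b (c v) := by
    intro N
    have : ∀ v : Fin (n + 1) → ℤ, ∃ i, (∀ k, 0 ≤ v k) → ∑ k, v k = ((N + 1 : ℕ) : ℤ) →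
        f (pt N v) i ≤ b i := by
      intro v
      by_cases h : (∀ k, 0 ≤ v k) ∧ ∑ k, v k = ((N + 1 : ℕ) : ℤ)
      · obtain ⟨i, hi⟩ := hcolor _ (hpt N v h.1 h.2)
        exact ⟨i, fun _ _ => hi⟩
      · exact ⟨0, fun h1 h2 => absurd ⟨h1, h2⟩ h⟩
    choose c hc using this
    exact ⟨c, hc⟩
  choose c hc using hc
  choose C y hne hy hclose hout using fun N => exists_close_lattice_points n (N + 1) (c N)
  -- The ultrafilter replaces subsequences: it makes the finitely valued `C N` constant and the grid
  -- points converge.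
  let F : Ultrafilter ℕ := hyperfilter ℕ
  have hF : (F : Filter ℕ) ≤ atTop := Nat.hyperfilter_le_atTop
  obtain ⟨C₀, hC₀⟩ : ∃ C₀, ∀ᶠ N in F, C N = C₀ := by
    have := (F.eventually_exists_iff (P := fun C₀ N => C N = C₀)).1
      (Eventually.of_forall fun N => ⟨C N, rfl⟩)
    exact this
  obtain ⟨i₀, hi₀⟩ : C₀.Nonempty := by
    obtain ⟨N, hN⟩ := hC₀.exists
    exact hN ▸ hne N
  have hmem : ∀ i ∈ C₀, ∀ᶠ N in F, pt N (y N i) ∈ stdSimplex ℝ (Fin (n + 1)) := by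
    intro i hi
    filter_upwards [hC₀] with N hN
    obtain ⟨h1, h2, -⟩ := hy N i (hN ▸ hi)
    exact hpt N _ h1 h2
  obtain ⟨x, hx, hlim⟩ := (isCompact_stdSimplex ℝ (Fin (n + 1))).ultrafilter_le_nhds
    (F.map fun N => pt N (y N i₀)) (by
      rw [le_principal_iff]
      exact hmem i₀ hi₀)
  have hlim : Tendsto (fun N => pt N (y N i₀)) F (𝓝 x) := hlim
  have hzero : Tendsto (fun N : ℕ => ((n : ℝ) + 1) / (N + 1)) F (𝓝 0) :=
    (tendsto_const_nhds.div_atTop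
      (tendsto_natCast_atTop_atTop.atTop_add tendsto_const_nhds)).mono_left hF
  have hlim' : ∀ i ∈ C₀, Tendsto (fun N => pt N (y N i)) F (𝓝 x) := by
    intro i hi
    rw [tendsto_pi_nhds] at hlim ⊢
    intro k
    have h0 : Tendsto (fun N => pt N (y N i) k - pt N (y N i₀) k) F (𝓝 0) := by
      refine squeeze_zero_norm' ?_ hzero
      filter_upwards [hC₀] with N hN
      have h := hclose N i (hN ▸ hi) i₀ (hN ▸ hi₀) k
      have hN : (0 : ℝ) < N + 1 := by positivity
      simp only [pt]
      rw [← sub_div, Real.norm_eq_abs, abs_div, abs_of_pos hN]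
      gcongr
      exact_mod_cast h
    simpa using h0.add (hlim k)
  have hle : ∀ i ∈ C₀, f x i ≤ b i := by
    intro i hi
    have h1 : Tendsto (fun N => f (pt N (y N i))) F (𝓝 (f x)) :=
      (hf x hx).tendsto.comp (tendsto_nhdsWithin_iff.2 ⟨hlim' i hi, hmem i hi⟩)
    refine le_of_tendsto (tendsto_pi_nhds.1 h1 i) ?_
    filter_upwards [hC₀] with N hN
    obtain ⟨h2, h3, h4⟩ := hy N i (hN ▸ hi)
    have := hc N _ h2 h3
    rwa [h4] at this
  have hvan : ∀ k ∉ C₀, f x k = 0 := by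
    intro k hk
    refine hface x hx k (le_antisymm ?_ (hx.1 k))
    refine le_of_tendsto_of_tendsto (tendsto_pi_nhds.1 hlim k) hzero ?_
    filter_upwards [hC₀] with N hN
    have h := hout N i₀ (hN ▸ hi₀) k (hN ▸ hk)
    simp only [pt]
    gcongr
    exact_mod_cast h
  -- Both points have coordinate sum 1, so these inequalities are equalities.
  have hall : ∀ i, f x i ≤ b i := fun i => by
    by_cases hi : i ∈ C₀
    · exact hle i hi
    · rw [hvan i hi]
      exact (hpos i).le
  refine ⟨x, hx, funext fun i => ?_⟩
  exact (Finset.sum_eq_sum_iff_of_le fun i _ => hall i).1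
    ((hmaps hx).2.trans hb.2.symm) i (Finset.mem_univ i)

/-! ### Piecewise affine extension -/

/-- The preimage in `s` of a closed set is cut out by the projection of a compact part of `G`, which
is closed in a Hausdorff space. -/
theorem continuousOn_of_isCompact_graph {X Y : Type*} [TopologicalSpace X] [T2Space X]
    [TopologicalSpace Y] {f : X → Y} {s : Set X} {G : Set (X × Y)} (hG : IsCompact G)
    (h : ∀ x ∈ s, ∀ y, (x, y) ∈ G ↔ y = f x) : ContinuousOn f s := by
  rw [continuousOn_iff_isClosed]
  intro A hA
  refine ⟨Prod.fst '' (G ∩ Prod.snd ⁻¹' A),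
    ((hG.inter_right (hA.preimage continuous_snd)).image continuous_fst).isClosed, ?_⟩
  ext x
  constructor
  · rintro ⟨hxA, hxs⟩
    exact ⟨⟨(x, f x), ⟨(h x hxs _).2 rfl, hxA⟩, rfl⟩, hxs⟩
  · rintro ⟨⟨⟨x, y⟩, ⟨hG, hy⟩, rfl⟩, hxs⟩
    refine ⟨?_, hxs⟩
    have := (h x hxs y).1 hG
    subst this
    exact hy

namespace Geometry.SimplicialComplex

/-- Barycentric coordinates on `s` are unique, so `w` vanishes off `r`. With `r` the intersection of
two simplices, this makes the affine extension well defined. -/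
theorem sum_smul_eq_of_subset {E F : Type*} [AddCommGroup E] [Module ℝ E] [AddCommGroup F]
    [Module ℝ F] (K : SimplicialComplex ℝ E) (g : E → F) {s r : Finset E} (hs : s ∈ K.faces)
    (hrs : r ⊆ s) {w w' : E → ℝ} (h1 : ∑ v ∈ s, w v = ∑ v ∈ r, w' v)
    (h2 : ∑ v ∈ s, w v • v = ∑ v ∈ r, w' v • v) :
    ∑ v ∈ s, w v • g v = ∑ v ∈ r, w' v • g v := by
  classical
  let w'' : E → ℝ := fun v => if v ∈ r then w' v else 0
  have hext : ∑ v ∈ s, w'' v • v = ∑ v ∈ r, w' v • v := by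
    rw [← Finset.sum_subset hrs fun v _ hv => by simp [w'', hv]]
    exact Finset.sum_congr rfl fun v hv => by simp [w'', hv]
  have hext1 : ∑ v ∈ s, w'' v = ∑ v ∈ r, w' v := by
    rw [← Finset.sum_subset hrs fun v _ hv => by simp [w'', hv]]
    exact Finset.sum_congr rfl fun v hv => by simp [w'', hv]
  have h := affineIndependent_iff.1 (K.indep hs) Finset.univ (fun v => w v - w'' v)
    (by
      rw [Finset.sum_coe_sort s (fun v => w v - w'' v), Finset.sum_sub_distrib, hext1, h1,
        sub_self])
    (by
      rw [Finset.sum_coe_sort s (fun v => (w v - w'' v) • v)]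
      simp only [sub_smul, Finset.sum_sub_distrib, h2, hext, sub_self])
  have hw : ∀ v ∈ s, w v = w'' v := fun v hv => sub_eq_zero.1 (h ⟨v, hv⟩ (Finset.mem_univ _))
  rw [← Finset.sum_subset hrs fun v hv hvr => by simp [hw v hv, w'', hvr]]
  exact Finset.sum_congr rfl fun v hv => by simp [hw v (hrs hv), w'', hv]

/-- A map on the vertices of a finite simplicial complex extends to a continuous map which is
affine on each simplex. -/
theorem exists_continuousOn_affine_extension {E F : Type*} [AddCommGroup E] [Module ℝ E]
    [TopologicalSpace E] [IsTopologicalAddGroup E] [ContinuousSMul ℝ E] [T2Space E]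
    [AddCommGroup F] [Module ℝ F] [TopologicalSpace F] [IsTopologicalAddGroup F]
    [ContinuousSMul ℝ F] (K : SimplicialComplex ℝ E) (hK : K.faces.Finite) (g : E → F) :
    ∃ f : E → F, ContinuousOn f K.space ∧ ∀ x ∈ K.space, ∃ s ∈ K.faces, ∃ w : E → ℝ,
      (∀ v ∈ s, 0 ≤ w v) ∧ ∑ v ∈ s, w v = 1 ∧ ∑ v ∈ s, w v • v = x ∧
        ∑ v ∈ s, w v • g v = f x := by
  classical
  have hex : ∀ x, ∃ z : F, x ∈ K.space → ∃ s ∈ K.faces, ∃ w : E → ℝ,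
      (∀ v ∈ s, 0 ≤ w v) ∧ ∑ v ∈ s, w v = 1 ∧ ∑ v ∈ s, w v • v = x ∧
        ∑ v ∈ s, w v • g v = z := by
    intro x
    by_cases hx : x ∈ K.space
    · obtain ⟨s, hs, hxs⟩ := mem_space_iff.1 hx
      obtain ⟨w, h0, h1, h2⟩ := Finset.mem_convexHull'.1 hxs
      exact ⟨_, fun _ => ⟨s, hs, w, h0, h1, h2, rfl⟩⟩
    · exact ⟨0, fun h => absurd h hx⟩
  choose f hf using hex
  refine ⟨f, ?_, hf⟩
  let G : Set (E × F) := ⋃ s ∈ K.faces, (fun w : s → ℝ =>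
    (∑ v, w v • (v : E), ∑ v, w v • g v)) '' stdSimplex ℝ s
  have hG : IsCompact G := hK.isCompact_biUnion fun s _ =>
    (isCompact_stdSimplex ℝ s).image (by fun_prop)
  have hGmem : ∀ x z, (x, z) ∈ G ↔ ∃ s ∈ K.faces, ∃ w : E → ℝ,
      (∀ v ∈ s, 0 ≤ w v) ∧ ∑ v ∈ s, w v = 1 ∧ ∑ v ∈ s, w v • v = x ∧
        ∑ v ∈ s, w v • g v = z := by
    intro x z
    simp only [G, Set.mem_iUnion, exists_prop, Set.mem_image, Prod.mk.injEq]
    constructor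
    · rintro ⟨s, hs, w, hw, h1, h2⟩
      let w' : E → ℝ := fun v => if h : v ∈ s then w ⟨v, h⟩ else 0
      have hw' : ∀ v : s, w v = w' v := fun v => by simp [w']
      refine ⟨s, hs, w', fun v hv => ?_, ?_, ?_, ?_⟩
      · rw [← hw' ⟨v, hv⟩]
        exact hw.1 _
      · rw [← hw.2, ← Finset.sum_coe_sort s w']
        exact Finset.sum_congr rfl fun v _ => (hw' v).symm
      · rw [← h1, ← Finset.sum_coe_sort s fun v => w' v • v]
        exact Finset.sum_congr rfl fun v _ => by rw [hw' v]
      · rw [← h2, ← Finset.sum_coe_sort s fun v => w' v • g v]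
        exact Finset.sum_congr rfl fun v _ => by rw [hw' v]
    · rintro ⟨s, hs, w, h0, h1, h2, h3⟩
      exact ⟨s, hs, fun v => w v, ⟨fun v => h0 v v.2, by rw [← h1, ← Finset.sum_coe_sort s w]⟩,
        by rw [← h2, ← Finset.sum_coe_sort s fun v => w v • v],
        by rw [← h3, ← Finset.sum_coe_sort s fun v => w v • g v]⟩
  refine continuousOn_of_isCompact_graph hG fun x hx z => ?_
  rw [hGmem]
  constructor
  · rintro ⟨s, hs, w, h0, h1, h2, h3⟩
    obtain ⟨t, ht, w', h0', h1', h2', h3'⟩ := hf x hx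
    have hx' : x ∈ convexHull ℝ ((s ∩ t : Finset E) : Set E) := by
      rw [Finset.coe_inter]
      exact K.inter_subset_convexHull hs ht
        ⟨Finset.mem_convexHull'.2 ⟨w, h0, h1, h2⟩, Finset.mem_convexHull'.2 ⟨w', h0', h1', h2'⟩⟩
    obtain ⟨w'', -, h1'', h2''⟩ := Finset.mem_convexHull'.1 hx'
    rw [← h3, ← h3', K.sum_smul_eq_of_subset g hs Finset.inter_subset_left (h1.trans h1''.symm)
      (h2.trans h2''.symm), K.sum_smul_eq_of_subset g ht Finset.inter_subset_right
      (h1'.trans h1''.symm) (h2'.trans h2''.symm)]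
  · rintro rfl
    exact hf x hx

end Geometry.SimplicialComplex

/-- A face-preserving assignment of points of the simplex to the vertices of a triangulation:
the images of the simplices of the triangulation cover the interior of the simplex. -/
theorem IsTriangulation.exists_sum_smul_eq {n : ℕ}
    {T : Geometry.SimplicialComplex ℝ (Fin (n + 1) → ℝ)} (hT : IsTriangulation T)
    (g : (Fin (n + 1) → ℝ) → Fin (n + 1) → ℝ)
    (hg : ∀ v ∈ T.vertices, g v ∈ stdSimplex ℝ (Fin (n + 1)))
    (hface : ∀ v ∈ T.vertices, ∀ i, v i = 0 → g v i = 0)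
    {b : Fin (n + 1) → ℝ} (hb : b ∈ stdSimplex ℝ (Fin (n + 1))) (hpos : ∀ i, 0 < b i) :
    ∃ s ∈ T.faces, ∃ w : (Fin (n + 1) → ℝ) → ℝ, (∀ v ∈ s, 0 ≤ w v) ∧ ∑ v ∈ s, w v = 1 ∧
      ∑ v ∈ s, w v • g v = b := by
  have hvert : ∀ s ∈ T.faces, ∀ v ∈ s, v ∈ T.vertices := fun s hs v hv => by
    rw [Geometry.SimplicialComplex.vertices_eq]
    exact Set.mem_biUnion hs hv
  obtain ⟨f, hf, hfw⟩ := T.exists_continuousOn_affine_extension hT.finite g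
  rw [hT.space_eq] at hf hfw
  obtain ⟨x, hx, hxb⟩ := exists_eq_of_preserves_faces f hf
    (by
      intro x hx
      obtain ⟨s, hs, w, h0, h1, -, h3⟩ := hfw x hx
      rw [← h3]
      exact (convex_stdSimplex ℝ _).sum_mem h0 h1 fun v hv => hg v (hvert s hs v hv))
    (by
      intro x hx i hi
      obtain ⟨s, hs, w, h0, h1, h2, h3⟩ := hfw x hx
      rw [← h2, Finset.sum_apply] at hi
      rw [← h3, Finset.sum_apply]
      refine Finset.sum_eq_zero fun v hv => ?_
      have hvΔ : v ∈ stdSimplex ℝ (Fin (n + 1)) := by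
        rw [← hT.space_eq]
        exact Geometry.SimplicialComplex.vertices_subset_space (hvert s hs v hv)
      have hz := (Finset.sum_eq_zero_iff_of_nonneg fun v' hv' => by
        have hv'Δ : v' ∈ stdSimplex ℝ (Fin (n + 1)) := by
          rw [← hT.space_eq]
          exact Geometry.SimplicialComplex.vertices_subset_space (hvert s hs v' hv')
        exact mul_nonneg (h0 v' hv') (hv'Δ.1 i)).1 hi v hv
      rcases mul_eq_zero.1 hz with h | h
      · simp [h]
      · simp [hface v (hvert s hs v hv) i h])
    hb hpos
  obtain ⟨s, hs, w, h0, h1, -, h3⟩ := hfw x hx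
  exact ⟨s, hs, w, h0, h1, h3.trans hxb⟩

/-! ### Averaging the labelings -/

/-- Lets the Sperner condition be applied to the smallest face containing `v`. -/
theorem mem_convexHull_simplexVertex {n : ℕ} {v : Fin (n + 1) → ℝ}
    (hv : v ∈ stdSimplex ℝ (Fin (n + 1))) :
    v ∈ convexHull ℝ (simplexVertex '' {i : Fin (n + 1) | v i ≠ 0}) := by
  classical
  have hsupp : ∀ i ∈ Finset.univ, i ∉ Finset.univ.filter (fun i => v i ≠ 0) → v i = 0 := by
    intro i _ hi
    simpa using hi
  have h1 : ∑ i ∈ Finset.univ.filter (fun i => v i ≠ 0), v i • simplexVertex i = v := by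
    rw [Finset.sum_subset (Finset.subset_univ _) fun i h hi => by
      rw [hsupp i h hi, zero_smul]]
    ext k
    simp [simplexVertex, Pi.single_apply]
  have h2 : ∑ i ∈ Finset.univ.filter (fun i => v i ≠ 0), v i = 1 := by
    rw [Finset.sum_subset (Finset.subset_univ _) hsupp, hv.2]
  have h3 := (convex_convexHull ℝ (simplexVertex '' {i : Fin (n + 1) | v i ≠ 0})).sum_mem
    (fun i _ => hv.1 i) h2 fun i hi => subset_convexHull ℝ _ ⟨i, by simpa using hi, rfl⟩
  rwa [h1] at h3

theorem theorem3 (n m : ℕ) (T : Geometry.SimplicialComplex ℝ (Fin (n + 1) → ℝ))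
    (hT : IsTriangulation T)
    (l : Fin m → (Fin (n + 1) → ℝ) → Fin (n + 1))
    (hl : ∀ j, IsSpernerLabeling T (l j))
    (k : Fin m → ℕ) (hk : ∀ j, 0 < k j) (hsum : ∑ j, k j = n + m) :
    ∃ τ ∈ T.faces, τ.card = n + 1 ∧ ∀ j, k j ≤ (τ.image (l j)).card := by
  rcases Nat.eq_zero_or_pos m with rfl | hm
  · have hne : (Pi.single 0 1 : Fin (n + 1) → ℝ) ∈ T.space := by
      rw [hT.space_eq]
      exact single_mem_stdSimplex ℝ 0
    obtain ⟨s, hs, -⟩ := Geometry.SimplicialComplex.mem_space_iff.1 hne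
    obtain ⟨t, ht, -, htc⟩ := hT.pure s hs
    exact ⟨t, ht, htc, fun j => j.elim0⟩
  have hm' : (0 : ℝ) < m := by exact_mod_cast hm
  have hn' : (0 : ℝ) < n + 1 := by positivity
  -- Relabels so that each original vertex `i` gets label `i`.
  let σ : ∀ _ : Fin m, Fin (n + 1) ≃ Fin (n + 1) := fun j =>
    Equiv.ofBijective _ (Finite.injective_iff_bijective.1 (hl j).injective)
  let h : Fin m → (Fin (n + 1) → ℝ) → Fin (n + 1) := fun j v => (σ j).symm (l j v)
  -- The k_j - 1 sum to n; the shares 1/m raise this to n + 1 and make the final inequality strict.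
  let α : Fin m → ℝ := fun j => ((k j : ℝ) - 1 + 1 / m) / (n + 1)
  have hα0 : ∀ j, 0 ≤ α j := by
    intro j
    have : (1 : ℝ) ≤ k j := by exact_mod_cast hk j
    have h2 : (0 : ℝ) ≤ 1 / m := by positivity
    exact div_nonneg (by linarith) hn'.le
  have hα1 : ∑ j, α j = 1 := by
    have : (∑ j, (k j : ℝ)) = n + m := by exact_mod_cast hsum
    simp only [α]
    rw [← Finset.sum_div, Finset.sum_add_distrib, Finset.sum_sub_distrib, this]
    simp only [Finset.sum_const, Finset.card_univ, Fintype.card_fin, nsmul_eq_mul]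
    field_simp
    ring
  let g : (Fin (n + 1) → ℝ) → Fin (n + 1) → ℝ := fun v => ∑ j, α j • Pi.single (h j v) 1
  have hgapp : ∀ v i, g v i = ∑ j, α j * (Pi.single (h j v) 1 : Fin (n + 1) → ℝ) i := by
    intro v i
    simp [g, Finset.sum_apply]
  have hsingle : ∀ j v i, 0 ≤ (Pi.single (h j v) 1 : Fin (n + 1) → ℝ) i := fun j v i =>
    (single_mem_stdSimplex ℝ (h j v)).1 i
  obtain ⟨s, hs, w, hw0, hw1, hwb⟩ := hT.exists_sum_smul_eq g
    (fun v _ => (convex_stdSimplex ℝ _).sum_mem (fun j _ => hα0 j) hα1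
      fun j _ => single_mem_stdSimplex ℝ _)
    (by
      intro v hv i hi
      rw [hgapp]
      refine Finset.sum_eq_zero fun j _ => ?_
      have hvΔ : v ∈ stdSimplex ℝ (Fin (n + 1)) := by
        rw [← hT.space_eq]
        exact Geometry.SimplicialComplex.vertices_subset_space hv
      obtain ⟨i', hi', hl'⟩ := (hl j).mem_face v hv _ (mem_convexHull_simplexVertex hvΔ)
      have hh : h j v = i' := (σ j).symm_apply_eq.2 hl'
      have hne : i ≠ i' := by
        rintro rfl
        exact hi' hi
      rw [hh, Pi.single_eq_of_ne hne, mul_zero])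
    (b := fun _ => 1 / (n + 1))
    ⟨fun _ => by positivity, by
      rw [Finset.sum_const, Finset.card_univ, Fintype.card_fin, nsmul_eq_mul]
      push_cast
      field_simp⟩
    (fun _ => by positivity)
  -- The simplex found may have lower dimension; enlarging it only adds labels.
  obtain ⟨t, ht, hst, htc⟩ := hT.pure s hs
  refine ⟨t, ht, htc, fun j => ?_⟩
  have hcard : (s.image (h j)).card ≤ (t.image (l j)).card := by
    calc (s.image (h j)).card = ((s.image (l j)).image (σ j).symm).card := by
          rw [Finset.image_image]
          rfl
      _ ≤ (s.image (l j)).card := Finset.card_image_le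
      _ ≤ _ := Finset.card_le_card (Finset.image_subset_image hst)
  refine le_trans ?_ hcard
  -- All labelings contribute nonnegatively to the coordinate 1/(n+1) of the barycenter.
  have hbound : ∀ i, ∑ v ∈ s, w v * (α j * (Pi.single (h j v) 1 : Fin (n + 1) → ℝ) i) ≤
      1 / (n + 1) := by
    intro i
    rw [← congrFun hwb i, Finset.sum_apply]
    refine Finset.sum_le_sum fun v hv => ?_
    rw [Pi.smul_apply, smul_eq_mul, hgapp]
    refine mul_le_mul_of_nonneg_left ?_ (hw0 v hv)
    exact Finset.single_le_sum
      (f := fun j => α j * (Pi.single (h j v) 1 : Fin (n + 1) → ℝ) i)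
      (fun j' _ => mul_nonneg (hα0 j') (hsingle j' v i)) (Finset.mem_univ j)
  have hαle : α j ≤ (s.image (h j)).card * (1 / (n + 1)) := by
    calc α j = ∑ v ∈ s, w v * α j := by rw [← Finset.sum_mul, hw1, one_mul]
      _ = ∑ v ∈ s, ∑ i ∈ s.image (h j),
          w v * (α j * (Pi.single (h j v) 1 : Fin (n + 1) → ℝ) i) := by
        refine Finset.sum_congr rfl fun v hv => ?_
        rw [Finset.sum_eq_single_of_mem (h j v) (Finset.mem_image_of_mem _ hv)
          fun i _ hi => by rw [Pi.single_eq_of_ne hi]; simp]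
        simp
      _ = ∑ i ∈ s.image (h j), ∑ v ∈ s,
          w v * (α j * (Pi.single (h j v) 1 : Fin (n + 1) → ℝ) i) := Finset.sum_comm
      _ ≤ ∑ i ∈ s.image (h j), 1 / ((n : ℝ) + 1) := Finset.sum_le_sum fun i _ => hbound i
      _ = _ := by rw [Finset.sum_const, nsmul_eq_mul]
  rw [mul_one_div, div_le_div_iff_of_pos_right hn'] at hαle
  have h2 : (0 : ℝ) < 1 / m := by positivity
  have h3 : (k j : ℝ) < (s.image (h j)).card + 1 := by linarith
  exact Nat.lt_succ_iff.1 (by exact_mod_cast h3)
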